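/- A ribbon graph $G$ consists of a finite set of $n\ge 1$ vertices, each vertex $v$ having $k_v\ge 1$ corners numbered $1,\dots,k_v$ in their cyclic order around $v$, and of $L$ internal lines. Each line $l$ is an untwisted ribbon joining two distinct corners (possibly of the same vertex); it is given an arbitrary direction, exiting at one of these corners and entering at the other. Every corner carries at most one end of a line; the remaining corners are external. The faces of $G$ are its boundary components, i.e. the cycles (fixed points included) of the permutation of all corners which first goes to the other end of the line hooked to the corner (and stays in place at an external corner) and then moves to the next corner in the cyclic order of the vertex; let $F$ be their number. $G$ is called orientable if its corners can be marked as "entering" or "exiting", alternately around each vertex, so that each line joins an exiting corner to an entering one. Put $\epsilon_{li}=1$ if $l$ enters at the corner $i$, $\epsilon_{li}=-1$ if $l$ exits at $i$, $\epsilon_{li}=0$ otherwise, and $\eta_{li}=|\epsilon_{li}|$. For corners $i\ne j$ of the same vertex put $\omega(i,j)=1$ if $i<j$ and $\omega(i,j)=-1$ if $i>j$. Fix a root vertex $\bar v$, and consider the two antisymmetric integer matrices of size $L+n-1$, indexed by the lines and by the vertices $v\neq\bar v$, $$B'=\begin{pmatrix} \sum_v\sum_{i\ne j;\, i,j\in v}(-1)^{i+j+1}\omega(i,j)\,\eta_{li}\,\eta_{l'j}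 & \sum_{i\in v}(-1)^{i+1}\eta_{li}\\ \sum_{i\in v}(-1)^{i}\eta_{li} & 0\end{pmatrix},\qquad B''=\begin{pmatrix} \sum_v\sum_{i\ne j;\, i,j\in v}\omega(i,j)\,\epsilon_{li}\,\epsilon_{l'j} & \sum_{i\in v}\epsilon_{li}\\ -\sum_{i\in v}\epsilon_{li} & 0\end{pmatrix}.$$ Let $G$ be orientable. Then for every choice of the root $\bar v$: * if $G$ has more than one face, then $\det B'=\det B''=0$; * if $G$ has exactly one face, then $\det B'=\det B''=2^{2g}$, where $g$ is the genus of $G$, i.e. the non-negative integer with $n-L+F=2-2g$ (which exists in this case). -/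

import Mathlib

/-- A finite ribbon graph with vertex set `V` and set of internal lines `L`.  The vertex `v` has
`valence v` corners, numbered (from `0`) in the cyclic order of the vertex.  Each line is an
untwisted ribbon which exits at one corner and enters at another one; the order of the two ends is
arbitrary.  A corner carries at most one end of a line, and the corners that carry none are
external. -/
structure RibbonGraph (V L : Type*) where
  valence : V → ℕ
  valence_pos : ∀ v, 0 < valence v
  exit : L → Σ v, Fin (valence v)
  enter : L → Σ v, Fin (valence v)
  injective : Function.Injective (Sum.elim exit enter)

namespace RibbonGraph

variable {V L : Type*}

/-- The corners of the graph: pairs (vertex, position at that vertex). -/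
abbrev Corner (G : RibbonGraph V L) := Σ v, Fin (G.valence v)

/-- The next corner in the cyclic order of the vertex. -/
def next (G : RibbonGraph V L) : Equiv.Perm G.Corner :=
  Equiv.sigmaCongrRight fun v => finRotate (G.valence v)

open Classical in
/-- The other end of the line hooked to a corner; an external corner is sent to itself. -/
noncomputable def otherEndFun (G : RibbonGraph V L) (c : G.Corner) : G.Corner :=
  if h : ∃ l, G.exit l = c then G.enter h.choose
  else if h : ∃ l, G.enter l = c then G.exit h.choose
  else c

theorem otherEndFun_exit (G : RibbonGraph V L) (l : L) :
    G.otherEndFun (G.exit l) = G.enter l := by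
  have h : ∃ l', G.exit l' = G.exit l := ⟨l, rfl⟩
  have h1 : h.choose = l := by
    have := G.injective (a₁ := Sum.inl h.choose) (a₂ := Sum.inl l) h.choose_spec
    simpa using this
  rw [otherEndFun, dif_pos h, h1]

theorem otherEndFun_enter (G : RibbonGraph V L) (l : L) :
    G.otherEndFun (G.enter l) = G.exit l := by
  have h0 : ¬ ∃ l', G.exit l' = G.enter l := by
    rintro ⟨l', h⟩
    have := G.injective (a₁ := Sum.inl l') (a₂ := Sum.inr l) h
    simp at this
  have h : ∃ l', G.enter l' = G.enter l := ⟨l, rfl⟩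
  have h1 : h.choose = l := by
    have := G.injective (a₁ := Sum.inr h.choose) (a₂ := Sum.inr l) h.choose_spec
    simpa using this
  rw [otherEndFun, dif_neg h0, dif_pos h, h1]

theorem otherEndFun_external (G : RibbonGraph V L) (c : G.Corner)
    (h1 : ¬ ∃ l, G.exit l = c) (h2 : ¬ ∃ l, G.enter l = c) : G.otherEndFun c = c := by
  rw [otherEndFun, dif_neg h1, dif_neg h2]

theorem otherEndFun_involutive (G : RibbonGraph V L) : Function.Involutive G.otherEndFun := by
  intro c
  by_cases h1 : ∃ l, G.exit l = c
  · obtain ⟨l, rfl⟩ := h1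
    rw [otherEndFun_exit, otherEndFun_enter]
  · by_cases h2 : ∃ l, G.enter l = c
    · obtain ⟨l, rfl⟩ := h2
      rw [otherEndFun_enter, otherEndFun_exit]
    · rw [otherEndFun_external G c h1 h2, otherEndFun_external G c h1 h2]

/-- The involution exchanging the two ends of each line and fixing the external corners. -/
noncomputable def otherEnd (G : RibbonGraph V L) : Equiv.Perm G.Corner :=
  G.otherEndFun_involutive.toPerm

/-- Following the boundary of the ribbon graph: go along the line hooked to the corner, then turn
to the next corner of the vertex reached.  (At an external corner one just turns around.) -/
noncomputable def facePerm (G : RibbonGraph V L) : Equiv.Perm G.Corner :=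
  G.next * G.otherEnd

/-- The faces of the ribbon graph: the cycles (fixed points included) of `facePerm`. -/
def Face (G : RibbonGraph V L) : Type _ :=
  Quotient (Equiv.Perm.SameCycle.setoid G.facePerm)

/-- The number `F` of faces. -/
noncomputable def numFaces (G : RibbonGraph V L) : ℕ := Nat.card G.Face

/-- The Euler characteristic `n - L + F`. -/
noncomputable def eulerChar [Fintype V] [Fintype L] (G : RibbonGraph V L) : ℤ :=
  (Fintype.card V : ℤ) - Fintype.card L + G.numFaces

/-- The graph is orientable: the corners can be marked as entering (`true`) or exiting (`false`),
alternately around each vertex, such that each line joins an exiting corner and an entering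
one. -/
def Orientable (G : RibbonGraph V L) : Prop :=
  ∃ s : G.Corner → Bool, (∀ c, s (G.next c) = !(s c)) ∧ ∀ l, s (G.enter l) = !(s (G.exit l))

section Matrices

variable [DecidableEq V]

/-- The incidence number between lines and corners: `1` if `l` enters at `c`, `-1` if it exits at
`c` and `0` otherwise. -/
def eps (G : RibbonGraph V L) (l : L) (c : G.Corner) : ℤ :=
  if G.enter l = c then 1 else if G.exit l = c then -1 else 0

/-- The unsigned incidence number. -/
def eta (G : RibbonGraph V L) (l : L) (c : G.Corner) : ℤ := |G.eps l c|

/-- `ω(i,j)` is `1` if `i < j` and `-1` if `i > j` (it is only used for `i ≠ j`). -/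
def omega {k : ℕ} (i j : Fin k) : ℤ := if i < j then 1 else if j < i then -1 else 0

variable [Fintype V]

/-- The vertex oscillations between the long variables,
`∑_v ∑_{i ≠ j ∈ v} (-1)^(i+j+1) ω(i,j) η_{li} η_{l'j}`.
(Numbering the corners from `0` instead of `1` does not change the sign.) -/
def oscillation (G : RibbonGraph V L) : Matrix L L ℤ := fun l l' =>
  ∑ v, ∑ i : Fin (G.valence v), ∑ j : Fin (G.valence v), if i = j then 0 else
    (-1) ^ ((i : ℕ) + (j : ℕ) + 1) * omega i j * G.eta l ⟨v, i⟩ * G.eta l' ⟨v, j⟩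

/-- The hypermomenta oscillations `∑_{i ∈ v} (-1)^(i+1) η_{li}` for the vertices `v` other than the
root.  (The exponent is `i` here, as the corners are numbered from `0`.) -/
def hypermomenta (G : RibbonGraph V L) (root : V) : Matrix L {v : V // v ≠ root} ℤ := fun l v =>
  ∑ i : Fin (G.valence v), (-1) ^ (i : ℕ) * G.eta l ⟨v, i⟩

/-- The antisymmetric matrix of the long variables and the hypermomenta. -/
def pfaffMatrix (G : RibbonGraph V L) (root : V) :
    Matrix (L ⊕ {v : V // v ≠ root}) (L ⊕ {v : V // v ≠ root}) ℤ :=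
  Matrix.fromBlocks G.oscillation (G.hypermomenta root) (-(G.hypermomenta root).transpose) 0

/-- The oscillations written with the signed incidence numbers,
`∑_v ∑_{i ≠ j ∈ v} ω(i,j) ε_{li} ε_{l'j}`. -/
def signedOscillation (G : RibbonGraph V L) : Matrix L L ℤ := fun l l' =>
  ∑ v, ∑ i : Fin (G.valence v), ∑ j : Fin (G.valence v), if i = j then 0 else
    omega i j * G.eps l ⟨v, i⟩ * G.eps l' ⟨v, j⟩

/-- The incidence matrix `∑_{i ∈ v} ε_{li}` for the vertices `v` other than the root. -/
def signedHypermomenta (G : RibbonGraph V L) (root : V) : Matrix L {v : V // v ≠ root} ℤ :=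
  fun l v => ∑ i : Fin (G.valence v), G.eps l ⟨v, i⟩

/-- The antisymmetric matrix written with the signed incidence numbers. -/
def signedPfaffMatrix (G : RibbonGraph V L) (root : V) :
    Matrix (L ⊕ {v : V // v ≠ root}) (L ⊕ {v : V // v ≠ root}) ℤ :=
  Matrix.fromBlocks G.signedOscillation (G.signedHypermomenta root)
    (-(G.signedHypermomenta root).transpose) 0

end Matrices

end RibbonGraph

/-! Let E be the signed line–corner matrix, J and N the permutation matrices of `otherEnd` and
`next`, and O the unitriangular order matrix. Erasing from the face permutation matrix the row of
one corner a gives P, and det(1 - P) is 1 if there is a single face and 0 otherwise. Multiplying 1 -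
P by J gives J - N plus one unit entry at the root. Since J = 1 - EᵀE and O⁻¹ is N cut open at every
vertex, this matrix is O⁻¹ minus a product through the space of lines and non-root vertices.
Sylvester's identity moves the determinant to that space (`det_sub_next`), and symmetrizing O turns
the result into B'' (`two_smul_one_sub`). Hence 2^(n-1) det B'' = 2^L det(1 - P), for any ribbon
graph. Orientability serves only to compare B' with B'' (`det_pfaffMatrix`). -/

namespace Matrix

/-! ### Determinants detecting a single cycle -/

/-- The permutation matrix of `σ` with the row `a` erased. -/
def erasedPermMatrix {C : Type*} [DecidableEq C] (σ : Equiv.Perm C) (a : C) : Matrix C C ℤ :=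
  fun i j => if σ i = j ∧ i ≠ a then 1 else 0

section erasedPermMatrix

variable {C : Type*} [DecidableEq C] [Fintype C] (σ : Equiv.Perm C) (a : C)

theorem erasedPermMatrix_mulVec (x : C → ℤ) (i : C) :
    (erasedPermMatrix σ a *ᵥ x) i = if i = a then 0 else x (σ i) := by
  by_cases h : i = a <;> simp [erasedPermMatrix, mulVec, dotProduct, h]

/-- The indicator of the cycle of `c` is invariant under `σ` and vanishes at `a`, so it lies in the
kernel. -/
theorem det_one_sub_erasedPermMatrix_of_not_sameCycle {c : C} (hc : ¬ σ.SameCycle a c) :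
    (1 - erasedPermMatrix σ a).det = 0 := by
  classical
  rw [← exists_mulVec_eq_zero_iff]
  refine ⟨fun i => if σ.SameCycle i c then 1 else 0, fun h => ?_, ?_⟩
  · have h1 := congrFun h c
    simp [Equiv.Perm.SameCycle.refl] at h1
  · ext i
    rw [sub_mulVec, one_mulVec, Pi.sub_apply, erasedPermMatrix_mulVec]
    by_cases h : i = a
    · subst h; simp [hc]
    · simp [h]

theorem erasedPermMatrix_pow_mulVec_eq_zero (m : ℕ) (x : C → ℤ) (i : C)
    (h : ∃ k < m, (σ ^ k) i = a) : ((erasedPermMatrix σ a) ^ m *ᵥ x) i = 0 := by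
  induction m generalizing i with
  | zero => simp at h
  | succ m ih =>
    rw [pow_succ', ← mulVec_mulVec, erasedPermMatrix_mulVec]
    split_ifs with hi
    · rfl
    · obtain ⟨k, hk, hka⟩ := h
      cases k with
      | zero => exact absurd hka hi
      | succ k => exact ih _ ⟨k, by omega, by simpa [pow_succ] using hka⟩

/-- Every orbit meets `a`, where the row is zero, in fewer than `orderOf σ` steps. -/
theorem isNilpotent_erasedPermMatrix (h : ∀ c, σ.SameCycle a c) :
    IsNilpotent (erasedPermMatrix σ a) := by
  refine ⟨orderOf σ, ?_⟩
  refine ext_of_mulVec_single fun j => funext fun i => ?_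
  rw [zero_mulVec]
  exact erasedPermMatrix_pow_mulVec_eq_zero σ a _ _ i (h i).symm.exists_pow_eq'

theorem det_one_sub_erasedPermMatrix_of_sameCycle (h : ∀ c, σ.SameCycle a c) :
    (1 - erasedPermMatrix σ a).det = 1 := by
  have h1 := (isNilpotent_charpoly_sub_pow_of_isNilpotent
    (isNilpotent_erasedPermMatrix σ a h)).eq_zero
  have h2 := (erasedPermMatrix σ a).eval_charpoly 1
  rw [sub_eq_zero.1 h1] at h2
  simpa using h2.symm

end erasedPermMatrix

/-- Block row operations absorb B X Bᵀ into the border, whatever X is; the powers of 2 and the sign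
come from rescaling blocks. -/
theorem two_pow_mul_det_fromBlocks {m n : Type*} [Fintype m] [Fintype n] [DecidableEq m]
    [DecidableEq n] (K Q : Matrix m m ℤ) (B : Matrix m n ℤ) (X : Matrix n n ℤ)
    (h : 2 • K = -(Q + B * X * Bᵀ)) :
    2 ^ Fintype.card m * (fromBlocks K (-B) (-Bᵀ) 0).det =
      2 ^ Fintype.card n * ((-1) ^ Fintype.card m * (fromBlocks Q B (-Bᵀ) 0).det) := by
  have h1 : fromBlocks (2 : Matrix m m ℤ) 0 0 (1 : Matrix n n ℤ) * fromBlocks K (-B) (-Bᵀ) 0 =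
      fromBlocks 1 (B * X) 0 1 * (fromBlocks (-1) 0 0 1 * fromBlocks Q B (-Bᵀ) 0) *
        fromBlocks 1 0 0 2 := by
    simp only [fromBlocks_multiply, mul_zero, zero_mul, add_zero, zero_add, one_mul, mul_one,
      neg_mul, mul_neg, Matrix.mul_assoc, Matrix.mul_zero, Matrix.zero_mul, Matrix.one_mul,
      Matrix.mul_one, Matrix.neg_mul, Matrix.mul_neg, neg_zero]
    congr 1
    · rw [two_mul, ← two_nsmul, h, Matrix.mul_assoc, neg_add]
    · rw [← diagonal_ofNat, ← diagonal_ofNat]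
      ext i j
      rw [neg_apply, neg_apply, diagonal_mul, mul_diagonal, mul_comm]
  have h2 : (2 : Matrix m m ℤ).det = 2 ^ Fintype.card m := by
    rw [← diagonal_ofNat, det_diagonal]; simp
  have h3 : (2 : Matrix n n ℤ).det = 2 ^ Fintype.card n := by
    rw [← diagonal_ofNat, det_diagonal]; simp
  have h4 := congrArg det h1
  simp only [det_mul, det_fromBlocks_zero₂₁, h2, h3, det_one, mul_one, one_mul, det_neg] at h4
  rw [h4]; ring

end Matrix

/-- Entrywise form of `stepMatrix_mul_orderMatrix` at one vertex: the third term undoes the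
wrap-around from the last corner to the first. -/
theorem finRotate_le_iff {k : ℕ} (i j : Fin k) (hk : 0 < k) :
    ((if i ≤ j then 1 else 0) - (if finRotate k i ≤ j then 1 else 0) +
      (if i = ⟨k - 1, by omega⟩ then 1 else 0) : ℤ) = if i = j then 1 else 0 := by
  obtain ⟨k, rfl⟩ : ∃ m, k = m + 1 := ⟨k - 1, by omega⟩
  by_cases h : i = Fin.last k
  · subst h
    have : Fin.last k ≤ j ↔ Fin.last k = j := by
      rw [Fin.last_le_iff, eq_comm]
    rw [finRotate_last]
    have h2 : Fin.last k = (⟨k + 1 - 1, by omega⟩ : Fin (k + 1)) := rfl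
    simp only [this, ← h2, Fin.zero_le, if_true]
    ring
  · have h' : (i : ℕ) < k := Fin.val_lt_last h
    have h1 : ((finRotate (k + 1) i : Fin (k + 1)) : ℕ) = i + 1 :=
      coe_finRotate_of_ne_last h
    simp only [Fin.le_def, h1, Fin.ext_iff]
    split_ifs <;> first | rfl | omega

theorem finRotate_mk {k i : ℕ} (hi : i + 1 < k) :
    finRotate k ⟨i, Nat.lt_of_succ_lt hi⟩ = ⟨i + 1, hi⟩ := by
  obtain ⟨k, rfl⟩ : ∃ m, k = m + 1 := ⟨k - 1, by omega⟩
  exact finRotate_of_lt (by omega)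

/-! ### Corners, lines and their incidence matrices -/

namespace RibbonGraph

variable {V L : Type*} (G : RibbonGraph V L)

/-- The first corner of a vertex. -/
def firstCorner (v : V) : G.Corner := ⟨v, ⟨0, G.valence_pos v⟩⟩

/-- The last corner of a vertex. -/
def lastCorner (v : V) : G.Corner := ⟨v, ⟨G.valence v - 1, Nat.sub_lt (G.valence_pos v) one_pos⟩⟩

theorem next_mk (v : V) (i : Fin (G.valence v)) :
    G.next ⟨v, i⟩ = ⟨v, finRotate (G.valence v) i⟩ := rfl

theorem next_lastCorner (v : V) : G.next (G.lastCorner v) = G.firstCorner v := by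
  have h : ∀ k (hk : 0 < k), finRotate k ⟨k - 1, Nat.sub_lt hk one_pos⟩ = ⟨0, hk⟩ := by
    intro k hk
    obtain ⟨k, rfl⟩ : ∃ m, k = m + 1 := ⟨k - 1, by omega⟩
    exact finRotate_last
  rw [lastCorner, next_mk, firstCorner, h _ (G.valence_pos v)]

theorem otherEnd_exit (l : L) : G.otherEnd (G.exit l) = G.enter l := G.otherEndFun_exit l

theorem otherEnd_enter (l : L) : G.otherEnd (G.enter l) = G.exit l := G.otherEndFun_enter l

theorem otherEnd_otherEnd (c : G.Corner) : G.otherEnd (G.otherEnd c) = c :=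
  G.otherEndFun_involutive c

theorem exit_ne_enter (l l' : L) : G.exit l ≠ G.enter l' := fun h => by
  simpa using G.injective (a₁ := Sum.inl l) (a₂ := Sum.inr l') h

theorem exit_injective : Function.Injective G.exit := fun l l' h => by
  simpa using G.injective (a₁ := Sum.inl l) (a₂ := Sum.inl l') h

theorem enter_injective : Function.Injective G.enter := fun l l' h => by
  simpa using G.injective (a₁ := Sum.inr l) (a₂ := Sum.inr l') h

section

variable [DecidableEq V]

theorem eps_eq_sub (l : L) (c : G.Corner) :
    G.eps l c = (if G.enter l = c then 1 else 0) - (if G.exit l = c then 1 else 0) := by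
  have := G.exit_ne_enter l l
  unfold eps
  split_ifs with h1 h2 <;> simp_all

theorem eps_enter [DecidableEq L] (l l' : L) :
    G.eps l (G.enter l') = if l = l' then 1 else 0 := by
  simp [eps_eq_sub, G.exit_ne_enter, G.enter_injective.eq_iff]

theorem eps_exit [DecidableEq L] (l l' : L) :
    G.eps l (G.exit l') = if l = l' then -1 else 0 := by
  have := G.exit_ne_enter l' l
  simp only [eps_eq_sub, this.symm, G.exit_injective.eq_iff, if_false]
  split_ifs <;> rfl

theorem eps_of_external (l : L) (c : G.Corner) (h1 : ¬ ∃ l, G.exit l = c)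
    (h2 : ¬ ∃ l, G.enter l = c) : G.eps l c = 0 := by
  rw [eps, if_neg fun h => h2 ⟨l, h⟩, if_neg fun h => h1 ⟨l, h⟩]

/-- The signed incidence matrix between lines and corners. -/
def epsMatrix : Matrix L G.Corner ℤ := Matrix.of G.eps

/-- The corners of a vertex in their linear order. -/
def orderMatrix : Matrix G.Corner G.Corner ℤ :=
  Matrix.blockDiagonal' fun _ => Matrix.of fun i j => if i ≤ j then 1 else 0

theorem orderMatrix_same (v : V) (i j : Fin (G.valence v)) :
    G.orderMatrix ⟨v, i⟩ ⟨v, j⟩ = if i ≤ j then 1 else 0 := by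
  simp [orderMatrix]

theorem orderMatrix_of_ne {v w : V} (h : v ≠ w) (i : Fin (G.valence v)) (j : Fin (G.valence w)) :
    G.orderMatrix ⟨v, i⟩ ⟨w, j⟩ = 0 := by
  simp [orderMatrix, Matrix.blockDiagonal'_apply, h]

theorem orderMatrix_firstCorner (v : V) (c : G.Corner) :
    G.orderMatrix (G.firstCorner v) c = if c.1 = v then 1 else 0 := by
  obtain ⟨w, j⟩ := c
  by_cases h : v = w
  · subst h
    simp [firstCorner, orderMatrix_same, Fin.le_def]
  · simp [firstCorner, G.orderMatrix_of_ne h, Ne.symm h]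

theorem orderMatrix_lastCorner (v : V) (c : G.Corner) :
    G.orderMatrix c (G.lastCorner v) = if c.1 = v then 1 else 0 := by
  obtain ⟨w, j⟩ := c
  by_cases h : w = v
  · subst h
    have : (j : ℕ) ≤ G.valence w - 1 := by omega
    simp [lastCorner, orderMatrix_same, Fin.le_def, this]
  · simp [lastCorner, G.orderMatrix_of_ne h, h]

variable [Fintype V]

theorem epsMatrix_mul_transpose [DecidableEq L] :
    G.epsMatrix * G.epsMatrix.transpose = 2 := by
  ext l l'
  simp only [Matrix.mul_apply, Matrix.transpose_apply, epsMatrix, Matrix.of_apply]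
  simp only [G.eps_eq_sub l, sub_mul, ite_mul, one_mul, zero_mul, Finset.sum_sub_distrib,
    Finset.sum_ite_eq, Finset.mem_univ, if_true, eps_enter, eps_exit]
  rw [← Matrix.diagonal_ofNat, Matrix.diagonal_apply]
  simp only [eq_comm (a := l')]
  split_ifs <;> rfl

omit [Fintype V] in
-- Each line contributes the block (1, -1; -1, 1) on its two ends; rows of external corners vanish
-- on both sides.
theorem transpose_mul_epsMatrix [Fintype L] :
    G.epsMatrix.transpose * G.epsMatrix = 1 - G.otherEnd.permMatrix ℤ := by
  classical
  ext c c'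
  simp only [Matrix.mul_apply, Matrix.transpose_apply, epsMatrix, Matrix.of_apply,
    Matrix.sub_apply, Matrix.one_apply, Equiv.Perm.permMatrix, PEquiv.toMatrix_apply,
    Equiv.toPEquiv_apply, Option.mem_some_iff]
  by_cases h1 : ∃ l, G.exit l = c
  · obtain ⟨l, rfl⟩ := h1
    simp only [eps_exit, otherEnd_exit, ite_mul, zero_mul, Finset.sum_ite_eq', Finset.mem_univ,
      if_true]
    rw [eps_eq_sub]
    ring
  · by_cases h2 : ∃ l, G.enter l = c
    · obtain ⟨l, rfl⟩ := h2
      simp only [eps_enter, otherEnd_enter, ite_mul, zero_mul, Finset.sum_ite_eq',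
        Finset.mem_univ, if_true]
      rw [eps_eq_sub]
      ring
    · rw [show G.otherEnd c = c from G.otherEndFun_external c h1 h2]
      simp [G.eps_of_external _ c h1 h2]

theorem det_otherEnd [Fintype L] : (G.otherEnd.permMatrix ℤ).det = (-1) ^ Fintype.card L := by
  classical
  have h : G.otherEnd.permMatrix ℤ = 1 - G.epsMatrix.transpose * G.epsMatrix := by
    rw [transpose_mul_epsMatrix, sub_sub_cancel]
  have h2 : (1 : Matrix L L ℤ) - 2 = -1 := by norm_num
  rw [h, Matrix.det_one_sub_mul_comm, epsMatrix_mul_transpose, h2, Matrix.det_neg, Matrix.det_one,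
    mul_one]

/-- Grading all corners by position makes the matrix block triangular; corners sharing a position
lie at distinct vertices, so the diagonal blocks are identities. -/
theorem det_orderMatrix : G.orderMatrix.det = 1 := by
  have h : G.orderMatrix.BlockTriangular fun c => (c.2 : ℕ) := by
    rintro ⟨v, i⟩ ⟨w, j⟩ hij
    by_cases hvw : v = w
    · subst hvw
      rw [orderMatrix_same, if_neg (not_le.2 (Fin.lt_def.2 hij))]
    · exact G.orderMatrix_of_ne hvw i j
  rw [h.det]
  refine Finset.prod_eq_one fun a _ => ?_
  suffices h1 : G.orderMatrix.toSquareBlock (fun c => (c.2 : ℕ)) a = 1 by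
    rw [h1, Matrix.det_one]
  ext ⟨⟨v, i⟩, hi⟩ ⟨⟨w, j⟩, hj⟩
  simp only [Matrix.toSquareBlock_def, Matrix.of_apply, Matrix.one_apply, Subtype.mk.injEq]
  by_cases hvw : v = w
  · subst hvw
    have hij : i = j := Fin.ext (hi.trans hj.symm)
    simp [orderMatrix_same, hij]
  · simp [G.orderMatrix_of_ne hvw, hvw]

/-- The shift of the corners which stops at the last corner of each vertex, subtracted from `1`. -/
def stepMatrix : Matrix G.Corner G.Corner ℤ :=
  1 - G.next.permMatrix ℤ +
    Matrix.of fun c c' => ∑ v, if c = G.lastCorner v ∧ c' = G.firstCorner v then 1 else 0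

theorem stepMatrix_mul_orderMatrix : G.stepMatrix * G.orderMatrix = 1 := by
  ext ⟨v, i⟩ ⟨w, j⟩
  rw [stepMatrix, add_mul, sub_mul, one_mul, Matrix.add_apply, Matrix.sub_apply,
    Equiv.Perm.permMatrix, PEquiv.toMatrix_toPEquiv_mul]
  have h : ((Matrix.of fun c c' => ∑ v, if c = G.lastCorner v ∧ c' = G.firstCorner v then 1 else 0 :
      Matrix G.Corner G.Corner ℤ) * G.orderMatrix) ⟨v, i⟩ ⟨w, j⟩ =
      if (⟨v, i⟩ : G.Corner) = G.lastCorner w then 1 else 0 := by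
    simp only [Matrix.mul_apply, Matrix.of_apply, Finset.sum_mul]
    rw [Finset.sum_comm, Fintype.sum_eq_single w fun x hx => ?_]
    · simp [ite_and, orderMatrix_firstCorner]
    · simp [ite_and, orderMatrix_firstCorner, hx.symm]
  rw [h, Matrix.submatrix_apply, next_mk, id]
  by_cases hvw : v = w
  · subst hvw
    rw [orderMatrix_same, orderMatrix_same, Matrix.one_apply]
    have := finRotate_le_iff i j (G.valence_pos v)
    simpa [lastCorner] using this
  · rw [G.orderMatrix_of_ne hvw, G.orderMatrix_of_ne hvw]
    simp [lastCorner, hvw]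

theorem det_stepMatrix : G.stepMatrix.det = 1 := by
  have h := congrArg Matrix.det G.stepMatrix_mul_orderMatrix
  rwa [Matrix.det_mul, det_orderMatrix, Matrix.det_one, mul_one] at h

/-! ### Reduction to lines and non-root vertices -/

/-- The vertices other than the root, as columns supported at their last corners. -/
def lastMatrix (root : V) : Matrix G.Corner {v : V // v ≠ root} ℤ :=
  Matrix.of fun c v => if c = G.lastCorner v then 1 else 0

/-- The vertices other than the root, as rows supported at their first corners. -/
def firstMatrix (root : V) : Matrix {v : V // v ≠ root} G.Corner ℤ :=
  Matrix.of fun v c => if c = G.firstCorner v then 1 else 0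

theorem orderMatrix_mul_lastMatrix (root : V) : G.orderMatrix * G.lastMatrix root =
    Matrix.of fun c v => if c.1 = v.1 then 1 else 0 := by
  ext c v
  simp [Matrix.mul_apply, lastMatrix, orderMatrix_lastCorner]

theorem firstMatrix_mul_orderMatrix (root : V) : G.firstMatrix root * G.orderMatrix =
    Matrix.of fun v c => if c.1 = v.1 then 1 else 0 := by
  ext v c
  simp [Matrix.mul_apply, firstMatrix, orderMatrix_firstCorner]

theorem epsMatrix_mul_orderMatrix_mul_lastMatrix (root : V) :
    G.epsMatrix * (G.orderMatrix * G.lastMatrix root) = G.signedHypermomenta root := by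
  ext l v
  rw [orderMatrix_mul_lastMatrix]
  simp only [Matrix.mul_apply, epsMatrix, Matrix.of_apply, Fintype.sum_sigma, signedHypermomenta]
  rw [Fintype.sum_eq_single v.1 (fun w hw => by simp [hw])]
  simp

theorem firstMatrix_mul_orderMatrix_mul_transpose (root : V) :
    G.firstMatrix root * G.orderMatrix * G.epsMatrix.transpose =
      (G.signedHypermomenta root).transpose := by
  rw [← epsMatrix_mul_orderMatrix_mul_lastMatrix, Matrix.transpose_mul, firstMatrix_mul_orderMatrix,
    orderMatrix_mul_lastMatrix]
  rfl

theorem firstMatrix_mul_orderMatrix_mul_lastMatrix (root : V) :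
    G.firstMatrix root * G.orderMatrix * G.lastMatrix root = 1 := by
  ext v w
  rw [firstMatrix_mul_orderMatrix]
  simp only [Matrix.mul_apply, lastMatrix, Matrix.of_apply]
  rw [Fintype.sum_eq_single (G.lastCorner w) fun c hc => by rw [if_neg hc, mul_zero]]
  simp [lastCorner, Matrix.one_apply, Subtype.ext_iff, eq_comm]

theorem stepMatrix_eq (root : V) : G.stepMatrix =
    1 - G.next.permMatrix ℤ + G.lastMatrix root * G.firstMatrix root +
      Matrix.single (G.lastCorner root) (G.firstCorner root) 1 := by
  rw [stepMatrix, add_assoc (1 - _)]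
  congr 1
  ext c c'
  rw [Matrix.of_apply, ← Finset.add_sum_erase _ _ (Finset.mem_univ root), add_comm]
  simp only [Matrix.add_apply, Matrix.mul_apply, lastMatrix, firstMatrix, Matrix.of_apply,
    Matrix.single_apply]
  congr 1
  · rw [Finset.sum_subtype (p := fun v => v ≠ root) (F := inferInstance) _ (by simp)]
    exact Finset.sum_congr rfl fun v _ => by rw [ite_and, ite_mul, one_mul, zero_mul]
  · simp [eq_comm]

/-- Factoring out `stepMatrix`, of determinant 1, leaves 1 - O·U·W with U and W passing through
lines and non-root vertices; det(1 - XY) = det(1 - YX) then applies. The corner block is 1 - 1 = 0.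
-/
theorem det_sub_next (root : V) [Fintype L] [DecidableEq L] :
    (G.otherEnd.permMatrix ℤ - G.next.permMatrix ℤ +
      Matrix.single (G.lastCorner root) (G.firstCorner root) 1).det =
    (Matrix.fromBlocks (1 - G.epsMatrix * G.orderMatrix * G.epsMatrix.transpose)
      (-G.signedHypermomenta root) (-(G.signedHypermomenta root).transpose) 0).det := by
  have h : G.otherEnd.permMatrix ℤ - G.next.permMatrix ℤ +
      Matrix.single (G.lastCorner root) (G.firstCorner root) 1 =
      G.stepMatrix * (1 - G.orderMatrix *
        (Matrix.fromCols G.epsMatrix.transpose (G.lastMatrix root) *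
          Matrix.fromRows G.epsMatrix (G.firstMatrix root))) := by
    rw [mul_sub, mul_one, ← mul_assoc, stepMatrix_mul_orderMatrix, one_mul,
      Matrix.fromCols_mul_fromRows, transpose_mul_epsMatrix, G.stepMatrix_eq root]
    abel
  rw [h, Matrix.det_mul, det_stepMatrix, one_mul, ← Matrix.mul_assoc, Matrix.det_one_sub_mul_comm,
    Matrix.mul_fromCols, Matrix.fromRows_mul_fromCols, ← Matrix.fromBlocks_one,
    sub_eq_add_neg, Matrix.fromBlocks_neg, Matrix.fromBlocks_add,
    epsMatrix_mul_orderMatrix_mul_lastMatrix, ← Matrix.mul_assoc, ← Matrix.mul_assoc,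
    ← Matrix.mul_assoc,
    firstMatrix_mul_orderMatrix_mul_transpose, firstMatrix_mul_orderMatrix_mul_lastMatrix]
  simp [sub_eq_add_neg]

/-! ### From the order matrix to the oscillations -/

theorem sum_eps (l : L) : ∑ c, G.eps l c = 0 := by
  simp [eps_eq_sub]

omit [Fintype V] in
theorem two_mul_orderMatrix (v : V) (i j : Fin (G.valence v)) :
    2 * G.orderMatrix ⟨v, i⟩ ⟨v, j⟩ =
      (if i = j then 1 else 0) + 1 + if i = j then 0 else omega i j := by
  rw [orderMatrix_same, omega]
  rcases lt_trichotomy i j with h | rfl | h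
  · simp [h, h.le, h.ne]
  · simp
  · simp [h, h.not_ge, h.ne', h.not_gt]

theorem epsMatrix_orderMatrix_apply (l l' : L) :
    2 * (G.epsMatrix * G.orderMatrix * G.epsMatrix.transpose) l l' =
      (G.epsMatrix * G.epsMatrix.transpose) l l' + G.signedOscillation l l' +
        ∑ v, (∑ i, G.eps l ⟨v, i⟩) * ∑ j, G.eps l' ⟨v, j⟩ := by
  have h1 : (G.epsMatrix * G.orderMatrix * G.epsMatrix.transpose) l l' =
      ∑ v, ∑ i, ∑ j, G.eps l ⟨v, i⟩ * G.orderMatrix ⟨v, i⟩ ⟨v, j⟩ * G.eps l' ⟨v, j⟩ := by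
    rw [Matrix.mul_assoc]
    simp only [Matrix.mul_apply, Matrix.transpose_apply, epsMatrix, Matrix.of_apply,
      Fintype.sum_sigma]
    refine Finset.sum_congr rfl fun v _ => Finset.sum_congr rfl fun i _ => ?_
    rw [Fintype.sum_eq_single v fun w hw => by simp [G.orderMatrix_of_ne hw.symm], Finset.mul_sum]
    simp only [mul_assoc]
  rw [h1]
  simp only [Matrix.mul_apply, Matrix.transpose_apply, epsMatrix, Matrix.of_apply,
      Fintype.sum_sigma, signedOscillation, Finset.mul_sum, Finset.sum_mul,
      ← Finset.sum_add_distrib]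
  refine Finset.sum_congr rfl fun v _ => ?_
  have h2 : ∀ i, G.eps l ⟨v, i⟩ * G.eps l' ⟨v, i⟩ =
      ∑ j, (if i = j then 1 else 0) * G.eps l ⟨v, i⟩ * G.eps l' ⟨v, j⟩ := fun i => by simp
  simp only [h2]
  rw [Finset.sum_add_distrib,
    Finset.sum_comm (f := fun i j => G.eps l ⟨v, j⟩ * G.eps l' ⟨v, i⟩)]
  simp only [← Finset.sum_add_distrib]
  refine Finset.sum_congr rfl fun i _ => Finset.sum_congr rfl fun j _ => ?_
  have h3 := G.two_mul_orderMatrix v i j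
  split_ifs at h3 ⊢ <;> linear_combination (G.eps l ⟨v, i⟩ * G.eps l' ⟨v, j⟩) * h3

theorem sum_eps_root (root : V) (l : L) :
    ∑ i, G.eps l ⟨root, i⟩ = -∑ v, G.signedHypermomenta root l v := by
  have h := G.sum_eps l
  rw [Fintype.sum_sigma, ← Finset.add_sum_erase _ _ (Finset.mem_univ root),
    Finset.sum_subtype (p := fun v => v ≠ root) _ (by simp)] at h
  exact eq_neg_of_add_eq_zero_left h

/-- At each vertex 2O is identity plus all-ones plus ω. The identity gives EEᵀ = 2, ω the
oscillations, and all-ones the products of vertex sums. The root's sum is minus the total of the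
others, whence the all-ones matrix in the middle factor. -/
theorem two_smul_one_sub [DecidableEq L] (root : V) :
    2 • (1 - G.epsMatrix * G.orderMatrix * G.epsMatrix.transpose) =
      -(G.signedOscillation + G.signedHypermomenta root * (1 + Matrix.of fun _ _ => 1 :
        Matrix {v : V // v ≠ root} {v : V // v ≠ root} ℤ) *
        (G.signedHypermomenta root).transpose) := by
  ext l l'
  have h := G.epsMatrix_orderMatrix_apply l l'
  rw [epsMatrix_mul_transpose, ← Finset.add_sum_erase _ _ (Finset.mem_univ root),
    Finset.sum_subtype (p := fun v => v ≠ root) _ (by simp), sum_eps_root _ root,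
    sum_eps_root _ root] at h
  have h2 : (G.signedHypermomenta root * (1 + Matrix.of fun _ _ => 1 :
        Matrix {v : V // v ≠ root} {v : V // v ≠ root} ℤ) *
        (G.signedHypermomenta root).transpose) l l' =
      ∑ v, G.signedHypermomenta root l v * G.signedHypermomenta root l' v +
        (∑ v, G.signedHypermomenta root l v) * ∑ v, G.signedHypermomenta root l' v := by
    rw [Matrix.mul_add, Matrix.mul_one, Matrix.add_mul, Matrix.add_apply]
    simp [Matrix.mul_apply, Finset.mul_sum]
  have h3 : (2 : Matrix L L ℤ) l l' = 2 * (1 : Matrix L L ℤ) l l' := by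
    rw [← Matrix.diagonal_ofNat, Matrix.diagonal_apply, Matrix.one_apply]; simp
  rw [h3] at h
  simp only [Matrix.smul_apply, Matrix.sub_apply, Matrix.neg_apply, Matrix.add_apply, h2]
  simp only [nsmul_eq_mul, Nat.cast_ofNat]
  have h4 : ∑ v : {v : V // v ≠ root}, (∑ i, G.eps l ⟨v, i⟩) * ∑ j, G.eps l' ⟨v, j⟩ =
    ∑ v, G.signedHypermomenta root l v * G.signedHypermomenta root l' v := rfl
  rw [h4] at h
  linear_combination -h

/-! ### Faces and the determinant of B'' -/

theorem otherEnd_mul_sub_next (root : V) :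
    G.otherEnd.permMatrix ℤ * (1 - Matrix.erasedPermMatrix G.facePerm
      (G.otherEnd (G.lastCorner root))) =
    G.otherEnd.permMatrix ℤ - G.next.permMatrix ℤ +
      Matrix.single (G.lastCorner root) (G.firstCorner root) 1 := by
  rw [mul_sub, mul_one, sub_add]
  congr 1
  ext c c'
  rw [Equiv.Perm.permMatrix, PEquiv.toMatrix_toPEquiv_mul, Matrix.submatrix_apply, id,
    Matrix.erasedPermMatrix, Matrix.sub_apply, Equiv.Perm.permMatrix, PEquiv.toMatrix_apply,
    Matrix.single_apply]
  simp only [facePerm, Equiv.Perm.mul_apply, otherEnd_otherEnd, Equiv.toPEquiv_apply,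
    Option.mem_some_iff, G.otherEnd.injective.ne_iff]
  by_cases h : c = G.lastCorner root
  · subst h; simp [next_lastCorner]
  · simp [h, Ne.symm h]

theorem two_pow_mul_det_signedPfaffMatrix [Fintype L] [DecidableEq L] (root : V) :
    2 ^ (Fintype.card V - 1) * (G.signedPfaffMatrix root).det = 2 ^ Fintype.card L *
      (1 - Matrix.erasedPermMatrix G.facePerm (G.otherEnd (G.lastCorner root))).det := by
  have h1 := congrArg Matrix.det (G.otherEnd_mul_sub_next root)
  have h2 := Matrix.two_pow_mul_det_fromBlocks _ _ _ _ (G.two_smul_one_sub root)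
  rw [Matrix.det_mul, det_otherEnd, det_sub_next] at h1
  have hV : Fintype.card {v : V // v ≠ root} = Fintype.card V - 1 := by simp
  rw [← h1, hV] at h2
  have h3 : ((-1 : ℤ) ^ Fintype.card L) * (-1) ^ Fintype.card L = 1 := by
    rw [← mul_pow]; simp
  rw [signedPfaffMatrix]
  linear_combination (-(-1) ^ Fintype.card L) * h2 +
    (2 ^ Fintype.card L * (1 - Matrix.erasedPermMatrix G.facePerm
        (G.otherEnd (G.lastCorner root))).det -
      2 ^ (Fintype.card V - 1) * (Matrix.fromBlocks G.signedOscillation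
        (G.signedHypermomenta root) (-(G.signedHypermomenta root).transpose) 0).det) * h3

/-! ### Antisymmetry and comparison of B' with B'' -/

theorem signedOscillation_antisymm (l l' : L) :
    G.signedOscillation l' l = -G.signedOscillation l l' := by
  simp only [signedOscillation, ← Finset.sum_neg_distrib]
  refine Finset.sum_congr rfl fun v _ => ?_
  rw [Finset.sum_comm]
  refine Finset.sum_congr rfl fun i _ => Finset.sum_congr rfl fun j _ => ?_
  simp only [omega]
  rcases lt_trichotomy i j with h | rfl | h
  · simp [h, h.ne, h.ne', h.not_gt, mul_comm]
  · simp
  · simp [h, h.ne, h.ne', h.not_gt, mul_comm]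

theorem transpose_signedPfaffMatrix (root : V) :
    (G.signedPfaffMatrix root).transpose = -G.signedPfaffMatrix root := by
  rw [signedPfaffMatrix, Matrix.fromBlocks_transpose, Matrix.fromBlocks_neg]
  congr 1
  · ext l l'; exact G.signedOscillation_antisymm l l'
  · simp

theorem even_of_det_signedPfaffMatrix_ne_zero [Fintype L] [DecidableEq L] (root : V)
    (h : (G.signedPfaffMatrix root).det ≠ 0) : Even (Fintype.card L + (Fintype.card V - 1)) := by
  have h1 := congrArg Matrix.det (G.transpose_signedPfaffMatrix root)
  rw [Matrix.det_transpose, Matrix.det_neg, Fintype.card_sum] at h1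
  have hV : Fintype.card {v : V // v ≠ root} = Fintype.card V - 1 := by simp
  rw [hV] at h1
  by_contra hodd
  rw [Nat.not_even_iff_odd] at hodd
  rw [hodd.neg_one_pow] at h1
  omega

theorem det_pfaffMatrix [Fintype L] [DecidableEq L] (hG : G.Orientable) (root : V) :
    (G.pfaffMatrix root).det = (G.signedPfaffMatrix root).det := by
  obtain ⟨s, hs, hl⟩ := hG
  let sg : G.Corner → ℤ := fun c => if s c then 1 else -1
  have sg_sq : ∀ c, sg c * sg c = 1 := fun c => by by_cases h : s c <;> simp [sg, h]
  -- Alternation around the vertex makes (-1)^i the marking, up to a sign depending only on the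
  -- vertex.
  have sg_pow : ∀ v (i : ℕ) (hi : i < G.valence v),
      (-1 : ℤ) ^ i = sg (G.firstCorner v) * sg ⟨v, ⟨i, hi⟩⟩ := by
    intro v i
    induction i with
    | zero => intro hi; rw [pow_zero]; exact (sg_sq _).symm
    | succ i ih =>
      intro hi
      have h1 : (⟨v, ⟨i + 1, hi⟩⟩ : G.Corner) = G.next ⟨v, ⟨i, by omega⟩⟩ := by
        rw [next_mk, finRotate_mk]
      have h2 : sg (G.next ⟨v, ⟨i, by omega⟩⟩) = -sg ⟨v, ⟨i, by omega⟩⟩ := by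
        simp only [sg, hs]
        cases s ⟨v, ⟨i, by omega⟩⟩ <;> rfl
      rw [h1, h2, pow_succ, ih (by omega)]
      ring
  have eta_eq : ∀ l c, G.eta l c = sg (G.enter l) * (sg c * G.eps l c) := by
    intro l c
    rw [eta]
    by_cases h1 : G.enter l = c
    · subst h1
      rw [← mul_assoc, sg_sq, eps, if_pos rfl]; rfl
    · by_cases h2 : G.exit l = c
      · subst h2
        rw [eps, if_neg h1, if_pos rfl]
        simp only [sg, hl]
        cases s (G.exit l) <;> rfl
      · rw [eps, if_neg h1, if_neg h2]; simp
  have pow_eta : ∀ l v (i : Fin (G.valence v)), (-1) ^ (i : ℕ) * G.eta l ⟨v, i⟩ =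
      sg (G.firstCorner v) * sg (G.enter l) * G.eps l ⟨v, i⟩ := by
    intro l v i
    rw [sg_pow v i i.2, eta_eq]
    linear_combination (sg (G.firstCorner v) * sg (G.enter l) * G.eps l ⟨v, i⟩) * sg_sq ⟨v, i⟩
  -- The oscillations of B' and B'' differ by a global sign, supplied by the transpose in `key`; the
  -- minus on the vertices restores the sign of the off-diagonal blocks.
  let d : L ⊕ {v : V // v ≠ root} → ℤ :=
    Sum.elim (fun l => sg (G.enter l)) fun v => -sg (G.firstCorner v)
  have hd : ∀ x, d x * d x = 1 := by rintro (l | v) <;> simp [d, sg_sq]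
  have hyp : ∀ l v, G.hypermomenta root l v =
      sg (G.firstCorner v) * sg (G.enter l) * G.signedHypermomenta root l v := by
    intro l v
    simp only [hypermomenta, signedHypermomenta, Finset.mul_sum, pow_eta]
  have osc : ∀ l l', G.oscillation l l' =
      -(sg (G.enter l) * sg (G.enter l') * G.signedOscillation l l') := by
    intro l l'
    simp only [oscillation, signedOscillation, Finset.mul_sum, ← Finset.sum_neg_distrib]
    refine Finset.sum_congr rfl fun v _ => Finset.sum_congr rfl fun i _ =>
      Finset.sum_congr rfl fun j _ => ?_
    split_ifs
    · simp
    · have h1 := pow_eta l v i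
      have h2 := pow_eta l' v j
      have h3 := sg_sq (G.firstCorner v)
      calc _ = -(omega i j * ((-1) ^ (i : ℕ) * G.eta l ⟨v, i⟩) *
            ((-1) ^ (j : ℕ) * G.eta l' ⟨v, j⟩)) := by ring
        _ = _ := by
          rw [h1, h2]
          linear_combination (-omega i j * sg (G.enter l) * sg (G.enter l') * G.eps l ⟨v, i⟩ *
            G.eps l' ⟨v, j⟩) * h3
  have key : G.pfaffMatrix root =
      Matrix.diagonal d * (G.signedPfaffMatrix root).transpose * Matrix.diagonal d := by
    ext x y
    rw [Matrix.mul_diagonal, Matrix.diagonal_mul, Matrix.transpose_apply]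
    rcases x with l | v <;> rcases y with l' | w
    · simp only [pfaffMatrix, signedPfaffMatrix, Matrix.fromBlocks_apply₁₁, osc, d, Sum.elim_inl]
      rw [G.signedOscillation_antisymm l l']; ring
    · simp only [pfaffMatrix, signedPfaffMatrix, Matrix.fromBlocks_apply₁₂,
        Matrix.fromBlocks_apply₂₁, hyp, d, Sum.elim_inl, Sum.elim_inr, Matrix.neg_apply,
        Matrix.transpose_apply]
      ring
    · simp only [pfaffMatrix, signedPfaffMatrix, Matrix.fromBlocks_apply₁₂,
        Matrix.fromBlocks_apply₂₁, hyp, d, Sum.elim_inl, Sum.elim_inr, Matrix.neg_apply,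
        Matrix.transpose_apply]
      ring
    · simp [pfaffMatrix, signedPfaffMatrix]
  rw [key, Matrix.det_mul, Matrix.det_mul, Matrix.det_transpose, Matrix.det_diagonal,
    mul_right_comm, ← Finset.prod_mul_distrib, Finset.prod_congr rfl fun x _ => hd x]
  simp

end

end RibbonGraph

/-! ### The main theorem -/

theorem mainTheorem1 {V L : Type*} [Fintype V] [DecidableEq V] [Fintype L] [DecidableEq L]
    (G : RibbonGraph V L) (hG : G.Orientable) (root : V) :
    (1 < G.numFaces →
      (G.pfaffMatrix root).det = 0 ∧ (G.signedPfaffMatrix root).det = 0) ∧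
    (G.numFaces = 1 →
      ∃ g : ℕ, G.eulerChar = 2 - 2 * (g : ℤ) ∧
        (G.pfaffMatrix root).det = 2 ^ (2 * g) ∧
        (G.signedPfaffMatrix root).det = 2 ^ (2 * g)) := by
  rw [G.det_pfaffMatrix hG root, and_self]
  simp only [and_self]
  have hdet := G.two_pow_mul_det_signedPfaffMatrix root
  set a := G.otherEnd (G.lastCorner root)
  have hfin : Finite G.Face := Quotient.finite _
  refine ⟨fun hF => ?_, fun hF => ?_⟩
  · obtain ⟨c, hc⟩ : ∃ c, ¬ G.facePerm.SameCycle a c := by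
      by_contra! h
      have : Subsingleton G.Face := ⟨fun x y => by
        induction x using Quotient.inductionOn
        induction y using Quotient.inductionOn
        exact Quotient.sound ((h _).symm.trans (h _))⟩
      exact absurd (Finite.card_le_one_iff_subsingleton.2 this) (not_le.2 hF)
    rw [Matrix.det_one_sub_erasedPermMatrix_of_not_sameCycle _ _ hc, mul_zero] at hdet
    simpa using hdet
  · have hs : Subsingleton G.Face := Finite.card_le_one_iff_subsingleton.1 hF.le
    have hc : ∀ c, G.facePerm.SameCycle a c := fun c =>
      Quotient.exact (hs.elim (Quotient.mk _ a : G.Face) (Quotient.mk _ c))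
    rw [Matrix.det_one_sub_erasedPermMatrix_of_sameCycle _ _ hc, mul_one] at hdet
    have hV : 0 < Fintype.card V := Fintype.card_pos_iff.2 ⟨root⟩
    -- This bound, hence g ≥ 0, follows from divisibility of powers of 2 since det B'' is an
    -- integer.
    have hle : Fintype.card V - 1 ≤ Fintype.card L := by
      have h : (2 : ℤ) ^ (Fintype.card V - 1) ∣ 2 ^ Fintype.card L := ⟨_, hdet.symm⟩
      exact Nat.pow_dvd_pow_iff_le_right (x := 2) (by norm_num) |>.1 (by exact_mod_cast h)
    have heven := G.even_of_det_signedPfaffMatrix_ne_zero root fun h => by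
      rw [h, mul_zero] at hdet
      exact absurd hdet.symm (by positivity)
    obtain ⟨m, hm⟩ := heven
    -- With L + (n - 1) = 2m, this g satisfies 2g = L - (n - 1); the subtraction does not truncate,
    -- by `hle`.
    refine ⟨m - (Fintype.card V - 1), ?_, ?_⟩
    · rw [RibbonGraph.eulerChar, hF]
      omega
    · have h : (2 : ℤ) ^ Fintype.card L =
          2 ^ (Fintype.card V - 1) * 2 ^ (2 * (m - (Fintype.card V - 1))) := by
        rw [← pow_add]; congr 1; omega
      rw [h] at hdet
      exact mul_left_cancel₀ (by positivity) hdet
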